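/- Let $\Gamma$ be a finitely generated group. A p.m.p. action of $\Gamma$ is an action by measure preserving Borel automorphisms on a standard Borel probability space $(X,\mu)$; it is free if for $\mu$-almost every $x$ the points $\gamma x$ ($\gamma\in\Gamma$) are pairwise distinct. A graphing of its orbit equivalence relation $R$ is a countable family of measure preserving Borel isomorphisms $\varphi_i\colon A_i\to B_i$ between Borel subsets of $X$ with $\varphi_i(x)\in\Gamma x$ for all $x\in A_i$; it generates $R$ if, for almost every $x$, the class of $x$ under the smallest equivalence relation with $z\sim\varphi_i(z)$ for all $i$ and all $z\in A_i$ is the orbit $\Gamma x$. The cost of the action is the infimum of $\sum_i\mu(A_i)\in[0,\infty]$ over the graphings that generate $R$. For a probability space $(K,\kappa)$, the i.i.d. process (Bernoulli action) with base $\kappa$ is the shift action of $\Gamma$ on $K^\Gamma$ with the product measure $\kappa^\Gamma$. A factor of it is a p.m.p. action on some $(Y,\nu)$ for which there is a measure preserving map $K^\Gamma\to Y$ that is almost everywhere $\Gamma$-equivariant. Then for every free p.m.p. action $f$ of $\Gamma$ and every free p.m.p. action $g$ of $\Gamma$ that is a factor of an i.i.d. process, the cost of $f$ is at most the cost of $g$.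 In particular, any two free p.m.p. actions of $\Gamma$ that are factors of i.i.d. processes (possibly with different bases) have the same cost. -/

import Mathlib

open MeasureTheory
open scoped ENNReal

noncomputable section

/-- The action of `Γ` on the measure space `(X, μ)` is free: for almost every point `x`,
distinct group elements move `x` to distinct points. -/
def IsFreeAction (Γ : Type*) [Group Γ] {X : Type*} [MeasurableSpace X] [MulAction Γ X]
    (μ : Measure X) : Prop :=
  ∀ᵐ x ∂μ, ∀ γ γ' : Γ, γ ≠ γ' → γ • x ≠ γ' • x

/-- A graphing of the equivalence relation `R` on `(X, μ)`: a countable family of measure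
preserving Borel isomorphisms `φ i : A i → B i` between Borel subsets of `X`, all of whose
graphs are contained in `R`. (`φ i` is a bijection from `source` onto `target`; finite
families are obtained by taking empty sources.) -/
structure Graphing {X : Type*} [MeasurableSpace X] (R : Setoid X) (μ : Measure X) where
  /-- The partial isomorphisms. -/
  φ : ℕ → PartialEquiv X X
  measurableSet_source : ∀ i, MeasurableSet (φ i).source
  measurableSet_target : ∀ i, MeasurableSet (φ i).target
  measurable_toFun : ∀ i, Measurable ((φ i).source.domRestrict (φ i))
  measurable_invFun : ∀ i, Measurable ((φ i).target.domRestrict (φ i).symm)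
  measure_image : ∀ i, ∀ s : Set X, MeasurableSet s → s ⊆ (φ i).source → μ (φ i '' s) = μ s
  rel : ∀ i, ∀ x ∈ (φ i).source, R x (φ i x)

namespace Graphing

variable {X : Type*} [MeasurableSpace X] {R : Setoid X} {μ : Measure X}

/-- The equivalence relation generated by a graphing: the smallest equivalence relation with
`x ∼ φ i x` for all `i` and all `x` in the domain of `φ i`. -/
def generatedRel (Φ : Graphing R μ) : X → X → Prop :=
  Relation.EqvGen fun x y => ∃ i, x ∈ (Φ.φ i).source ∧ Φ.φ i x = y

/-- A graphing generates `R` if, up to a null set, the equivalence relation it generates is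
`R`: for almost every `x`, the two equivalence classes of `x` coincide. -/
def Generates (Φ : Graphing R μ) : Prop :=
  ∀ᵐ x ∂μ, ∀ y, R x y ↔ Φ.generatedRel x y

/-- The cost of a graphing: the sum of the measures of the domains. -/
def cost (Φ : Graphing R μ) : ℝ≥0∞ :=
  ∑' i, μ (Φ.φ i).source

end Graphing

/-- The cost of an equivalence relation on `(X, μ)`: the infimum of the costs of the graphings
that generate it. -/
def relCost {X : Type*} [MeasurableSpace X] (R : Setoid X) (μ : Measure X) : ℝ≥0∞ :=
  ⨅ (Φ : Graphing R μ) (_ : Φ.Generates), Φ.cost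

/-- The cost of an action of `Γ` on `(X, μ)`: the cost of its orbit equivalence relation. -/
def actionCost (Γ : Type*) [Group Γ] {X : Type*} [MeasurableSpace X] [MulAction Γ X]
    (μ : Measure X) : ℝ≥0∞ :=
  relCost (MulAction.orbitRel Γ X) μ

/-- The shift of `Γ` on the set of maps from `Γ` to `K`. -/
def bernoulliShift {Γ : Type*} [Group Γ] {K : Type*} (γ : Γ) (ω : Γ → K) : Γ → K :=
  fun δ => ω (δ * γ)

/-- The product measure on the set of maps from `Γ` to the probability space `(K, κ)`. -/
def bernoulliMeasure (Γ : Type*) {K : Type*} [MeasurableSpace K] (κ : Measure K)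
    [IsProbabilityMeasure κ] : Measure (Γ → K) :=
  Measure.infinitePi fun _ : Γ => κ

/-- The action of `Γ` on `(Y, ν)` is a factor of the Bernoulli action (i.i.d. process) with base
`(K, κ)`: there is a measure preserving map from the product space to `(Y, ν)` that is
equivariant almost everywhere. (Such a map is automatically surjective up to a null set.) -/
def IsFactorOfBernoulli (Γ : Type*) [Group Γ] {K : Type*} [MeasurableSpace K] (κ : Measure K)
    [IsProbabilityMeasure κ] {Y : Type*} [MeasurableSpace Y] [MulAction Γ Y]
    (ν : Measure Y) : Prop :=
  ∃ π : (Γ → K) → Y, MeasurePreserving π (bernoulliMeasure Γ κ) ν ∧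
    ∀ γ : Γ, ∀ᵐ ω ∂(bernoulliMeasure Γ κ), π (bernoulliShift γ ω) = γ • π ω

end

/-!
The cost of a free action is an infimum over families `A γ` of measurable sets: a graphing may be
cut into the pieces on which it acts as a given `γ`, and by freeness this does not raise its cost.
Whether such a family connects `y` to `s • y` for all `s` in a finite generating set is decided by
finite patterns: it means that, for some finite set `T` of pairs `(δ, γ)` whose edges `δ — γ δ`
connect `1` to every `s` in the Cayley graph, `δ • y ∈ A γ` for all `(δ, γ) ∈ T`.

For a factor of a Bernoulli shift the sets `A γ` can be pulled back to `Γ → K`. Up to a small error,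
finitely many patterns suffice there and the finitely many sets involved depend on finitely many
coordinates, say those in `H`. It remains to imitate the Bernoulli shift on an arbitrary free action
`X` (`exists_equivariant_lintegral_le`). Cut `X` into finitely many cells such that for most `x` the
points `γ • x`, `γ ∈ H`, lie in distinct cells, and give the cells independent random labels `ω` of
law `κ`. The map `θ` with `θ x γ = ω (cell of γ • x)` is exactly equivariant, and for most `x` the
`H`-coordinates of `θ x` have the Bernoulli law. Averaging over the labels, some labelling makes the
sets obtained on `X` at most slightly larger than the `A γ`, while all but a small set of points
realize one of the patterns (`exists_transfer_patterns`). Adding the generators on this small set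
yields a generating graphing of `X` whose cost is hardly larger (`actionCost_le_tsum`). No
assumption that `Γ` is infinite is needed, because only the average over the labels matters and no
concentration around it.
-/

/-! ### Product measures under injective reindexing -/

/-- Reading an i.i.d. family along an injective map of index sets gives an i.i.d. family with the
same base. This covers both the shift and the passage to subfamilies. -/
theorem infinitePi_map_comp_injective {ι ι' K : Type*} [MeasurableSpace K] (κ : Measure K)
    [IsProbabilityMeasure κ] {f : ι → ι'} (hf : Function.Injective f) :
    (Measure.infinitePi fun _ : ι' => κ).map (fun ω i => ω (f i)) =
      Measure.infinitePi fun _ : ι => κ := by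
  classical
  have hm : Measurable (fun (ω : ι' → K) (i : ι) => ω (f i)) := by fun_prop
  refine Measure.eq_infinitePi _ fun s t ht => ?_
  rw [Measure.map_apply hm (MeasurableSet.pi s.countable_toSet fun i _ => ht i)]
  rcases isEmpty_or_nonempty ι with hι | hι
  · simp [Finset.eq_empty_of_isEmpty s]
  have hpre : (fun (ω : ι' → K) (i : ι) => ω (f i)) ⁻¹' ((s : Set ι).pi t) =
      ((s.image f : Finset ι') : Set ι').pi (fun j => t (Function.invFun f j)) := by
    ext ω
    simp [Set.mem_pi, Function.leftInverse_invFun hf _]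
  rw [hpre, Measure.infinitePi_pi _ fun j _ => ht _, Finset.prod_image hf.injOn]
  simp [Function.leftInverse_invFun hf _]

section Bernoulli

variable {Γ K : Type*} [Group Γ] [MeasurableSpace K] (κ : Measure K) [IsProbabilityMeasure κ]

theorem measurable_bernoulliShift (γ : Γ) :
    Measurable (bernoulliShift γ : (Γ → K) → Γ → K) := by
  unfold bernoulliShift
  fun_prop

theorem measurePreserving_bernoulliShift (γ : Γ) :
    MeasurePreserving (bernoulliShift γ) (bernoulliMeasure Γ κ) (bernoulliMeasure Γ κ) :=
  ⟨measurable_bernoulliShift γ, infinitePi_map_comp_injective κ (mul_left_injective γ)⟩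

instance : IsProbabilityMeasure (bernoulliMeasure Γ κ) := by
  unfold bernoulliMeasure
  infer_instance

/-- The integral of a function of finitely many coordinates over the product space can be computed
in any product space into which these coordinates embed. -/
theorem lintegral_comp_injOn {ι J : Type*} (θ : (J → K) → ι → K) {c : ι → J}
    (hθ : ∀ ω i, θ ω i = ω (c i)) {H : Finset ι} (hc : Set.InjOn c H) {f : (ι → K) → ℝ≥0∞}
    (hf : Measurable f) (hfH : DependsOn f (H : Set ι)) :
    ∫⁻ ω, f (θ ω) ∂(Measure.infinitePi fun _ : J => κ) =
      ∫⁻ ω, f ω ∂(Measure.infinitePi fun _ : ι => κ) := by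
  classical
  obtain ⟨k⟩ : Nonempty K := nonempty_of_isProbabilityMeasure κ
  -- `f` factors through the restriction to `H`: extend by a constant outside `H`.
  let ext : (H → K) → ι → K := fun u i => if h : i ∈ H then u ⟨i, h⟩ else k
  have hext : Measurable ext := by
    refine measurable_pi_lambda _ fun i => ?_
    by_cases h : i ∈ H
    · simpa [ext, h] using measurable_pi_apply _
    · simp [ext, h]
  have h1 : ∀ ω, f (θ ω) = (f ∘ ext) (fun i : H => ω (c i)) := fun ω =>
    hfH fun i hi => by
      have hi' : i ∈ H := hi
      simp [ext, hi', hθ]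
  have h2 : ∀ ω, f ω = (f ∘ ext) (fun i : H => ω i) := fun ω =>
    hfH fun i hi => by
      have hi' : i ∈ H := hi
      simp [ext, hi']
  simp_rw [h1, h2]
  rw [← lintegral_map (f := f ∘ ext) (g := fun (ω : J → K) (i : H) => ω (c i))
      (hf.comp hext) (by fun_prop),
    ← lintegral_map (f := f ∘ ext) (g := fun (ω : ι → K) (i : H) => ω i)
      (hf.comp hext) (by fun_prop),
    infinitePi_map_comp_injective κ (f := fun i : H => c i)
      (fun a b h => Subtype.ext (hc a.2 b.2 h)),
    infinitePi_map_comp_injective κ (f := fun i : H => (i : ι)) Subtype.val_injective]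

/-! ### Random equivariant maps to the Bernoulli shift -/

variable {X : Type*} [MeasurableSpace X] [StandardBorelSpace X] [MulAction Γ X]
  [MeasurableConstSMul Γ X] (μ : Measure X) [IsProbabilityMeasure μ]

/-- For a free action there is a finite measurable partition whose cells separate the translates of
most points by the elements of a given finite set. -/
theorem exists_cells_separating (hμ : IsFreeAction Γ μ) (H : Finset Γ) {ε : ℝ≥0∞} (hε : 0 < ε) :
    ∃ (n : ℕ) (c : X → (Fin n → Bool)), Measurable c ∧
      MeasurableSet {x | Set.InjOn (fun γ : Γ => c (γ • x)) H} ∧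
      μ {x | Set.InjOn (fun γ : Γ => c (γ • x)) H}ᶜ ≤ ε := by
  let c (n : ℕ) (x : X) : Fin n → Bool := fun i => MeasurableSpace.mapNatBool X x i
  have hc : ∀ n, Measurable (c n) := fun n =>
    measurable_pi_lambda _ fun i =>
      (measurable_pi_apply _).comp (MeasurableSpace.measurable_mapNatBool X)
  let G (n : ℕ) : Set X := {x | Set.InjOn (fun γ : Γ => c n (γ • x)) H}
  have hG : ∀ n, MeasurableSet (G n) := by
    intro n
    have : G n = ⋂ γ ∈ H, ⋂ γ' ∈ H, {x | c n (γ • x) = c n (γ' • x) → γ = γ'} := by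
      ext x
      simp only [G, Set.InjOn, Set.mem_ofPred_eq, Set.mem_iInter, Finset.mem_coe]
    rw [this]
    refine Finset.measurableSet_biInter _ fun γ _ => Finset.measurableSet_biInter _ fun γ' _ => ?_
    exact (measurableSet_eq_fun ((hc n).comp (measurable_const_smul γ))
      ((hc n).comp (measurable_const_smul γ'))).imp (MeasurableSet.const _)
  have hmono : Antitone fun n => (G n)ᶜ := by
    intro m n hmn
    refine Set.compl_subset_compl.2 fun x hx γ hγ γ' hγ' h => hx hγ hγ' ?_
    funext i
    exact congrFun h (Fin.castLE hmn i)
  have hnull : μ (⋂ n, (G n)ᶜ) = 0 := by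
    refine measure_mono_null ?_ (ae_iff.1 hμ)
    intro x hx hfree
    have : ∀ γ ∈ H, ∀ γ' ∈ H, ∀ᶠ n in Filter.atTop, c n (γ • x) = c n (γ' • x) → γ = γ' := by
      intro γ _ γ' _
      by_cases h : γ = γ'
      · exact Filter.Eventually.of_forall fun _ _ => h
      obtain ⟨k, hk⟩ := Function.ne_iff.1
        ((MeasurableSpace.injective_mapNatBool X).ne (hfree γ γ' h))
      filter_upwards [Filter.eventually_gt_atTop k] with n hn h'
      exact absurd (congrFun h' ⟨k, hn⟩) hk
    simp_rw [← Filter.eventually_all_finset] at this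
    obtain ⟨n, hn⟩ := this.exists
    exact Set.mem_iInter.1 hx n fun γ hγ γ' hγ' => hn γ hγ γ' hγ'
  have hlim := tendsto_measure_iInter_atTop (μ := μ) (s := fun n => (G n)ᶜ)
    (fun n => (hG n).compl.nullMeasurableSet) hmono ⟨0, measure_ne_top _ _⟩
  rw [hnull] at hlim
  obtain ⟨n, hn⟩ := (hlim.eventually (ge_mem_nhds hε)).exists
  exact ⟨n, c n, hc n, hG n, hn⟩

/-- Weak containment of the Bernoulli shift in an arbitrary free action, in integrated form: a
bounded functional of finitely many coordinates has, along some exactly equivariant map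
`X → (Γ → K)`, an average that exceeds its Bernoulli average by arbitrarily little. -/
theorem exists_equivariant_lintegral_le (hμ : IsFreeAction Γ μ) {f : (Γ → K) → ℝ≥0∞}
    (hf : Measurable f) {H : Finset Γ} (hfH : DependsOn f (H : Set Γ)) {M : ℝ≥0∞} (hM : M ≠ ∞)
    (hfM : ∀ ω, f ω ≤ M) {ε : ℝ≥0∞} (hε : 0 < ε) :
    ∃ θ : X → Γ → K, Measurable θ ∧ (∀ (γ : Γ) x, θ (γ • x) = bernoulliShift γ (θ x)) ∧
      ∫⁻ x, f (θ x) ∂μ ≤ ∫⁻ ω, f ω ∂(bernoulliMeasure Γ κ) + ε := by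
  obtain ⟨δ, hδ, hδM⟩ : ∃ δ : ℝ≥0∞, 0 < δ ∧ M * δ ≤ ε := by
    by_cases h0 : M = 0
    · exact ⟨1, one_pos, by simp [h0]⟩
    by_cases hε' : ε = ∞
    · exact ⟨1, one_pos, by simp [hε']⟩
    · exact ⟨ε / M, ENNReal.div_pos hε.ne' hM, (ENNReal.mul_div_cancel h0 hM).le⟩
  obtain ⟨n, c, hc, hG, hGδ⟩ := exists_cells_separating μ hμ H hδ
  -- Colour the cells independently; the colouring `ω` is an auxiliary random parameter.
  let P : Measure ((Fin n → Bool) → K) := Measure.infinitePi fun _ => κ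
  let θ (x : X) (ω : (Fin n → Bool) → K) : Γ → K := fun γ => ω (c (γ • x))
  have hθ : Measurable (Function.uncurry θ) := by
    refine measurable_pi_lambda _ fun γ => ?_
    have h1 : Measurable fun p : ((Fin n → Bool) → K) × (Fin n → Bool) => p.1 p.2 :=
      measurable_from_prod_countable_left fun y => measurable_pi_apply y
    exact h1.comp (measurable_snd.prodMk (hc.comp ((measurable_const_smul γ).comp measurable_fst)))
  have hfθ : Measurable (Function.uncurry fun x ω => f (θ x ω)) := hf.comp hθ
  set I := ∫⁻ ω, f ω ∂(bernoulliMeasure Γ κ) with hI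
  set G := {x | Set.InjOn (fun γ : Γ => c (γ • x)) H} with hGdef
  have hswap : ∫⁻ ω, ∫⁻ x, f (θ x ω) ∂μ ∂P ≤ I + ε := by
    rw [← lintegral_lintegral_swap hfθ.aemeasurable, ← lintegral_add_compl _ hG]
    refine add_le_add ?_ ?_
    · calc ∫⁻ x in G, ∫⁻ ω, f (θ x ω) ∂P ∂μ = ∫⁻ _ in G, I ∂μ :=
            setLIntegral_congr_fun hG fun x hx =>
              lintegral_comp_injOn κ (θ x) (c := fun γ => c (γ • x)) (fun _ _ => rfl) hx hf hfH
        _ ≤ I := by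
            rw [setLIntegral_const]
            exact mul_le_of_le_one_right' prob_le_one
    · calc ∫⁻ x in Gᶜ, ∫⁻ ω, f (θ x ω) ∂P ∂μ ≤ ∫⁻ _ in Gᶜ, M ∂μ := by
            refine lintegral_mono fun x => ?_
            calc ∫⁻ ω, f (θ x ω) ∂P ≤ ∫⁻ _, M ∂P := lintegral_mono fun ω => hfM _
              _ = M := by simp
        _ = M * μ Gᶜ := setLIntegral_const _ _
        _ ≤ M * δ := by gcongr
        _ ≤ ε := hδM
  obtain ⟨ω, hω⟩ := exists_le_lintegral (μ := P) (f := fun ω => ∫⁻ x, f (θ x ω) ∂μ)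
    hfθ.lintegral_prod_left'.aemeasurable
  refine ⟨fun x => θ x ω, hθ.comp (measurable_id.prodMk measurable_const), fun γ x => ?_,
    hω.trans hswap⟩
  funext δ'
  simp [θ, bernoulliShift, mul_smul]

end Bernoulli

/-! ### Transferring finite patterns from a factor to a free action -/

theorem ENNReal.exists_pos_natCast_mul_le (k : ℕ) {ε : ℝ≥0∞} (hε : 0 < ε) :
    ∃ η : ℝ≥0∞, 0 < η ∧ k * η ≤ ε := by
  by_cases hε' : ε = ∞
  · exact ⟨1, one_pos, by simp [hε']⟩
  refine ⟨ε / (k + 1 : ℕ), ENNReal.div_pos hε.ne' (ENNReal.natCast_ne_top _), ?_⟩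
  calc (k : ℝ≥0∞) * (ε / (k + 1 : ℕ)) ≤ (k + 1 : ℕ) * (ε / (k + 1 : ℕ)) := by
        gcongr
        exact Nat.le_succ k
    _ ≤ ε := ENNReal.mul_div_le

/-- Measurable sets in a product space are approximated by measurable sets that depend on finitely
many coordinates. -/
theorem exists_dependsOn_measure_symmDiff_lt {ι K : Type*} [MeasurableSpace K]
    (P : Measure (ι → K)) [IsFiniteMeasure P] {s : Set (ι → K)} (hs : MeasurableSet s) {η : ℝ≥0∞}
    (hη : 0 < η) :
    ∃ (t : Set (ι → K)) (H : Finset ι), MeasurableSet t ∧ DependsOn (· ∈ t) (H : Set ι) ∧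
      P (symmDiff t s) < η := by
  obtain ⟨t, ht, hts⟩ := exists_measure_symmDiff_lt_of_generateFrom_isSetRing (μ := P)
    (isSetRing_measurableCylinders (α := fun _ : ι => K))
    ⟨{Set.univ}, Set.countable_singleton _,
      Set.singleton_subset_iff.2 (univ_mem_measurableCylinders _), by simp⟩
    generateFrom_measurableCylinders.symm hs hη
  refine ⟨t, measurableCylinders.finset ht, MeasurableSet.of_mem_measurableCylinders ht, ?_, hts⟩
  intro ω ω' h
  have key : (measurableCylinders.finset ht).restrict ω =
      (measurableCylinders.finset ht).restrict ω' := by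
    funext i
    exact h i i.2
  have e := measurableCylinders.eq_cylinder ht
  have hm : ∀ ω, ω ∈ t ↔ (measurableCylinders.finset ht).restrict ω ∈ measurableCylinders.set ht :=
    fun ω => by
      conv_lhs => rw [e]
      exact mem_cylinder _ _ _
  simp only [hm, key]

section Transfer

variable {Γ K : Type*} [Group Γ] [Countable Γ] [MeasurableSpace K] (κ : Measure K)
  [IsProbabilityMeasure κ]
  {X : Type*} [MeasurableSpace X] [StandardBorelSpace X] [MulAction Γ X]
  [MeasurableConstSMul Γ X] (μ : Measure X) [IsProbabilityMeasure μ]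

/-- Let `A γ` be a family of measurable sets in a factor of a Bernoulli shift such that almost
every point `y` realizes one of the finite patterns in `𝒯`, that is, `δ • y ∈ A γ` for all
`(δ, γ)` in the pattern. Then every free action has a family `B γ` whose total measure is hardly
larger, such that only a set of small measure (with a prescribed weight `n`) fails to realize a
pattern in `𝒯`. -/
theorem exists_transfer_patterns {Y : Type*} [MeasurableSpace Y] [MulAction Γ Y]
    {ν : Measure Y} (hμ : IsFreeAction Γ μ) (hν : IsFactorOfBernoulli Γ κ ν)
    {A : Γ → Set Y} (hA : ∀ γ, MeasurableSet (A γ)) (𝒯 : Set (Finset (Γ × Γ)))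
    (h𝒯 : ∀ᵐ y ∂ν, ∃ T ∈ 𝒯, ∀ p ∈ T, p.1 • y ∈ A p.2) (n : ℕ) {ε : ℝ≥0∞} (hε : 0 < ε) :
    ∃ B : Γ → Set X, (∀ γ, MeasurableSet (B γ)) ∧
      ∑' γ, μ (B γ) + n * μ {x | ¬ ∃ T ∈ 𝒯, ∀ p ∈ T, p.1 • x ∈ B p.2} ≤ ∑' γ, ν (A γ) + ε := by
  classical
  obtain ⟨π, hπ, hequiv⟩ := hν
  let P := bernoulliMeasure Γ κ
  have hAm : ∀ γ, MeasurableSet (π ⁻¹' A γ) := fun γ => hπ.measurable (hA γ)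
  have hε3 : 0 < ε / 3 := ENNReal.div_pos hε.ne' (by simp)
  -- Finitely many patterns suffice up to a small error.
  let N (T : Finset (Γ × Γ)) : Set (Γ → K) := {ω | ∀ p ∈ T, bernoulliShift p.1 ω ∈ π ⁻¹' A p.2}
  have hN : ∀ T, MeasurableSet (N T) := by
    intro T
    have : N T = ⋂ p ∈ T, bernoulliShift p.1 ⁻¹' (π ⁻¹' A p.2) := by ext ω; simp [N]
    rw [this]
    exact Finset.measurableSet_biInter _ fun p _ => measurable_bernoulliShift p.1 (hAm p.2)
  let bad (𝒮 : Finset (Finset (Γ × Γ))) : Set (Γ → K) := {ω | ∀ T ∈ 𝒮, T ∈ 𝒯 → ω ∉ N T}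
  have hbad : ∀ 𝒮, MeasurableSet (bad 𝒮) := by
    intro 𝒮
    have : bad 𝒮 = ⋂ T ∈ 𝒮, {ω | T ∈ 𝒯 → ω ∉ N T} := by ext ω; simp [bad]
    rw [this]
    exact Finset.measurableSet_biInter _ fun T _ => (MeasurableSet.const _).imp (hN T).compl
  have hbad0 : P (⋂ 𝒮, bad 𝒮) = 0 := by
    have h1 : ∀ᵐ ω ∂P, ∃ T ∈ 𝒯, ∀ p ∈ T, p.1 • π ω ∈ A p.2 :=
      hπ.quasiMeasurePreserving.ae h𝒯
    have h2 : ∀ᵐ ω ∂P, ∀ γ : Γ, π (bernoulliShift γ ω) = γ • π ω := ae_all_iff.2 hequiv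
    refine measure_mono_null ?_ (ae_iff.1 (h1.and h2))
    rintro ω hω ⟨⟨T, hT, hp⟩, he⟩
    refine Set.mem_iInter.1 hω {T} T (Finset.mem_singleton_self T) hT fun p hpT => ?_
    rw [Set.mem_preimage, he]
    exact hp p hpT
  obtain ⟨𝒮, h𝒮⟩ : ∃ 𝒮, n * P (bad 𝒮) ≤ ε / 3 := by
    obtain ⟨δ, hδ, hnδ⟩ := ENNReal.exists_pos_natCast_mul_le n hε3
    have hlim := tendsto_measure_iInter_atTop (μ := P) (s := bad)
      (fun 𝒮 => (hbad 𝒮).nullMeasurableSet) (fun 𝒮 𝒮' h ω hω T hT => hω T (h hT))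
      ⟨∅, measure_ne_top _ _⟩
    rw [hbad0] at hlim
    obtain ⟨𝒮, h⟩ := (hlim.eventually (ge_mem_nhds hδ)).exists
    exact ⟨𝒮, (by gcongr; exact h : (n : ℝ≥0∞) * P (bad 𝒮) ≤ n * δ).trans hnδ⟩
  let W : Finset (Γ × Γ) := 𝒮.biUnion id
  have hW : ∀ T ∈ 𝒮, ∀ p ∈ T, p ∈ W := fun T hT p hp => Finset.mem_biUnion.2 ⟨T, hT, hp⟩
  let F : Finset Γ := W.image Prod.snd
  have hF : ∀ p ∈ W, p.2 ∈ F := fun p hp => Finset.mem_image_of_mem _ hp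
  -- Replace the sets by sets depending on finitely many coordinates.
  obtain ⟨η, hη, hηε⟩ := ENNReal.exists_pos_natCast_mul_le (F.card + n * W.card) hε3
  choose C D hC hD hCA using fun γ => exists_dependsOn_measure_symmDiff_lt P (hAm γ) hη
  let bad' : Set (Γ → K) := {ω | ∀ T ∈ 𝒮, T ∈ 𝒯 → ¬ ∀ p ∈ T, bernoulliShift p.1 ω ∈ C p.2}
  have hbad' : MeasurableSet bad' := by
    have : bad' = ⋂ T ∈ 𝒮, {ω | T ∈ 𝒯 → ω ∈ (⋂ p ∈ T, bernoulliShift p.1 ⁻¹' C p.2)ᶜ} := by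
      ext ω; simp [bad']
    rw [this]
    exact Finset.measurableSet_biInter _ fun T _ => (MeasurableSet.const _).imp
      (Finset.measurableSet_biInter _ fun p _ => measurable_bernoulliShift p.1 (hC p.2)).compl
  have hPbad' : P bad' ≤ P (bad 𝒮) + W.card * η := by
    have hsub : bad' ⊆ bad 𝒮 ∪
        ⋃ p ∈ W, bernoulliShift p.1 ⁻¹' symmDiff (C p.2) (π ⁻¹' A p.2) := by
      intro ω hω
      by_contra hcon
      simp only [Set.mem_union, not_or, Set.mem_iUnion, not_exists] at hcon
      obtain ⟨h1, h2⟩ := hcon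
      refine h1 fun T hT hT' hNT => hω T hT hT' fun p hp => ?_
      by_contra hpC
      exact h2 p (hW T hT p hp) (Or.inr ⟨hNT p hp, hpC⟩)
    calc P bad' ≤ P (bad 𝒮) + ∑ p ∈ W, P (bernoulliShift p.1 ⁻¹' symmDiff (C p.2) (π ⁻¹' A p.2)) :=
          (measure_mono hsub).trans ((measure_union_le _ _).trans
            (add_le_add le_rfl (measure_biUnion_finset_le _ _)))
      _ ≤ P (bad 𝒮) + ∑ p ∈ W, η := by
          gcongr with p _
          rw [(measurePreserving_bernoulliShift κ p.1).measure_preimage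
            ((hC p.2).symmDiff (hAm p.2)).nullMeasurableSet]
          exact (hCA p.2).le
      _ = P (bad 𝒮) + W.card * η := by rw [Finset.sum_const, nsmul_eq_mul]
  have hPC : ∀ γ, P (C γ) ≤ ν (A γ) + η := by
    intro γ
    rw [← hπ.measure_preimage (hA γ).nullMeasurableSet]
    refine (measure_mono (t := π ⁻¹' A γ ∪ symmDiff (C γ) (π ⁻¹' A γ)) fun ω hω => ?_).trans
      ((measure_union_le _ _).trans (add_le_add le_rfl (hCA γ).le))
    by_cases h : ω ∈ π ⁻¹' A γ
    · exact Or.inl h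
    · exact Or.inr (Or.inl ⟨hω, h⟩)
  -- The quantity to be controlled on `X` is the average of the following functional.
  let f : (Γ → K) → ℝ≥0∞ := fun ω =>
    ∑ γ ∈ F, (C γ).indicator 1 ω + n * bad'.indicator 1 ω
  have hfm : Measurable f :=
    (Finset.measurable_fun_sum _ fun γ _ => measurable_one.indicator (hC γ)).add
      ((measurable_one.indicator hbad').const_mul _)
  have hf_int : ∀ m : Measure (Γ → K),
      ∫⁻ ω, f ω ∂m = ∑ γ ∈ F, m (C γ) + n * m bad' := by
    intro m
    simp only [f]
    rw [lintegral_add_right _ ((measurable_one.indicator hbad').const_mul _),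
      lintegral_finsetSum _ fun γ _ => measurable_one.indicator (hC γ),
      lintegral_const_mul _ (measurable_one.indicator hbad'), lintegral_indicator_one hbad']
    simp_rw [fun γ => lintegral_indicator_one (μ := m) (hC γ)]
  let H : Finset Γ := F.biUnion D ∪ W.biUnion fun p => (D p.2).image (· * p.1)
  have hfH : DependsOn f (H : Set Γ) := by
    intro ω ω' h
    have h1 : ∀ γ ∈ F, (ω ∈ C γ ↔ ω' ∈ C γ) := fun γ hγ => by
      refine iff_of_eq (hD γ fun i hi => h i ?_)
      exact Finset.mem_union_left _ (Finset.mem_biUnion.2 ⟨γ, hγ, hi⟩)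
    have h2 : ∀ p ∈ W, (bernoulliShift p.1 ω ∈ C p.2 ↔ bernoulliShift p.1 ω' ∈ C p.2) :=
      fun p hp => by
        refine iff_of_eq (hD p.2 fun i hi => h _ ?_)
        exact Finset.mem_union_right _
          (Finset.mem_biUnion.2 ⟨p, hp, Finset.mem_image_of_mem _ hi⟩)
    have h3 : ω ∈ bad' ↔ ω' ∈ bad' :=
      forall₃_congr fun T hT _ => not_congr (forall₂_congr fun p hp => h2 p (hW T hT p hp))
    refine congrArg₂ (· + ·) (Finset.sum_congr rfl fun γ hγ => ?_) ?_
    · by_cases hω : ω ∈ C γ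
      · simp [hω, (h1 γ hγ).1 hω]
      · simp [hω, mt (h1 γ hγ).2 hω]
    · by_cases hω : ω ∈ bad'
      · simp [hω, h3.1 hω]
      · simp [hω, mt h3.2 hω]
  have hfM : ∀ ω, f ω ≤ F.card + n := by
    intro ω
    have h1 : ∀ s : Set (Γ → K), s.indicator (1 : (Γ → K) → ℝ≥0∞) ω ≤ 1 := fun s =>
      Set.indicator_le_self' (fun _ _ => zero_le) ω
    calc f ω ≤ ∑ γ ∈ F, 1 + n * 1 := by
          refine add_le_add (Finset.sum_le_sum fun γ _ => h1 _) ?_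
          gcongr
          exact h1 _
      _ = F.card + n := by simp
  obtain ⟨θ, hθ, hθe, hθf⟩ := exists_equivariant_lintegral_le κ μ hμ hfm hfH
    (by simp : (F.card + n : ℝ≥0∞) ≠ ∞) hfM hε3
  rw [← lintegral_map hfm hθ, hf_int, Measure.map_apply hθ hbad'] at hθf
  simp_rw [fun γ => Measure.map_apply (μ := μ) hθ (hC γ)] at hθf
  have hint : ∫⁻ ω, f ω ∂P ≤ ∑' γ, ν (A γ) + ε / 3 + ε / 3 := by
    rw [hf_int P]
    calc ∑ γ ∈ F, P (C γ) + n * P bad'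
        ≤ ∑ γ ∈ F, (ν (A γ) + η) + n * (P (bad 𝒮) + W.card * η) := by
          gcongr with γ _
          exact hPC γ
      _ = ∑ γ ∈ F, ν (A γ) + n * P (bad 𝒮) + (F.card + n * W.card : ℕ) * η := by
          rw [Finset.sum_add_distrib, Finset.sum_const, nsmul_eq_mul]
          push_cast
          ring
      _ ≤ ∑' γ, ν (A γ) + ε / 3 + ε / 3 := by
          gcongr
          exact ENNReal.sum_le_tsum _
  refine ⟨fun γ => if γ ∈ F then θ ⁻¹' C γ else ∅, fun γ => ?_, ?_⟩
  · dsimp only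
    split_ifs
    · exact hθ (hC γ)
    · exact MeasurableSet.empty
  have hsum : ∑' γ, μ (if γ ∈ F then θ ⁻¹' C γ else ∅) = ∑ γ ∈ F, μ (θ ⁻¹' C γ) := by
    rw [tsum_eq_sum (s := F) fun γ hγ => by simp [hγ]]
    exact Finset.sum_congr rfl fun γ hγ => by simp [hγ]
  have hsub : {x | ¬ ∃ T ∈ 𝒯, ∀ p ∈ T, p.1 • x ∈ if p.2 ∈ F then θ ⁻¹' C p.2 else ∅} ⊆
      θ ⁻¹' bad' := by
    intro x hx T hT hT' hp
    refine hx ⟨T, hT', fun p hpT => ?_⟩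
    rw [if_pos (hF p (hW T hT p hpT)), Set.mem_preimage, hθe]
    exact hp p hpT
  calc _ ≤ ∑ γ ∈ F, μ (θ ⁻¹' C γ) + n * μ (θ ⁻¹' bad') := by
        rw [hsum]
        gcongr
    _ ≤ ∑' γ, ν (A γ) + ε / 3 + ε / 3 + ε / 3 := hθf.trans (add_le_add hint le_rfl)
    _ = ∑' γ, ν (A γ) + ε := by rw [add_assoc, add_assoc, ← add_assoc (ε / 3), ENNReal.add_thirds]

end Transfer

/-! ### Graphings as families of sets indexed by the group -/

section Graphings

variable {Γ : Type*} [Group Γ] {X : Type*} [MeasurableSpace X] [MulAction Γ X]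
  {μ : Measure X}

/-- The edges of the graphing that moves the points of `A γ` by `γ`, for every `γ`. -/
def smulEdge (A : Γ → Set X) (x y : X) : Prop :=
  ∃ γ, x ∈ A γ ∧ γ • x = y

/-- The directed graph on `Γ` with an edge from `δ` to `γ * δ` for every `(δ, γ) ∈ T`. It is the
trace of `smulEdge A` on a free orbit `Γ • x`, if `T` is the set of all `(δ, γ)` with
`δ • x ∈ A γ`. -/
def patternEdge (T : Set (Γ × Γ)) (a b : Γ) : Prop :=
  ∃ γ, (a, γ) ∈ T ∧ γ * a = b

theorem patternEdge_mono {T T' : Set (Γ × Γ)} (h : T ⊆ T') {a b : Γ}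
    (hab : Relation.EqvGen (patternEdge T) a b) : Relation.EqvGen (patternEdge T') a b :=
  hab.mono fun _ _ ⟨γ, hγ, e⟩ => ⟨γ, h hγ, e⟩

/-- Connectedness in the graph of a pattern is witnessed by finitely many edges. -/
theorem exists_finset_eqvGen_patternEdge [DecidableEq Γ] {T : Set (Γ × Γ)} {a b : Γ}
    (h : Relation.EqvGen (patternEdge T) a b) :
    ∃ T₀ : Finset (Γ × Γ), (T₀ : Set (Γ × Γ)) ⊆ T ∧
      Relation.EqvGen (patternEdge (T₀ : Set _)) a b := by
  induction h with
  | rel a b hab =>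
    obtain ⟨γ, hγ, e⟩ := hab
    exact ⟨{(a, γ)}, by simpa using hγ, .rel _ _ ⟨γ, by simp, e⟩⟩
  | refl a => exact ⟨∅, by simp, .refl _⟩
  | symm a b _ ih =>
    obtain ⟨T₀, h, e⟩ := ih
    exact ⟨T₀, h, e.symm⟩
  | trans a b c _ _ ih₁ ih₂ =>
    obtain ⟨T₁, h₁, e₁⟩ := ih₁
    obtain ⟨T₂, h₂, e₂⟩ := ih₂
    refine ⟨T₁ ∪ T₂, by simp [h₁, h₂],
      (patternEdge_mono ?_ e₁).trans _ _ _ (patternEdge_mono ?_ e₂)⟩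
    · simp
    · simp

theorem eqvGen_smulEdge_of_patternEdge {Γ X : Type*} [Group Γ] [MulAction Γ X] {A : Γ → Set X}
    {T : Set (Γ × Γ)} {x : X}
    (hT : ∀ p ∈ T, p.1 • x ∈ A p.2) {a b : Γ} (h : Relation.EqvGen (patternEdge T) a b) :
    Relation.EqvGen (smulEdge A) (a • x) (b • x) := by
  induction h with
  | rel a b hab =>
    obtain ⟨γ, hγ, rfl⟩ := hab
    exact .rel _ _ ⟨γ, hT _ hγ, (mul_smul γ a x).symm⟩
  | refl a => exact .refl _
  | symm a b _ ih => exact ih.symm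
  | trans a b c _ _ ih₁ ih₂ => exact ih₁.trans _ _ _ ih₂

namespace Graphing

/-- The set of points that are moved by `γ` under one of the maps of the graphing. -/
def moved (Φ : Graphing (MulAction.orbitRel Γ X) μ) (γ : Γ) : Set X :=
  {x | ∃ i, x ∈ (Φ.φ i).source ∧ Φ.φ i x = γ • x}

theorem measurableSet_source_inter_eq_smul [MeasurableEq X] [MeasurableConstSMul Γ X]
    (Φ : Graphing (MulAction.orbitRel Γ X) μ) (i : ℕ) (γ : Γ) :
    MeasurableSet {x | x ∈ (Φ.φ i).source ∧ Φ.φ i x = γ • x} := by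
  have h := (Φ.measurableSet_source i).subtype_image (measurableSet_eq_fun (Φ.measurable_toFun i)
    ((measurable_const_smul γ).comp measurable_subtype_coe))
  convert h using 1
  ext x
  simp [Set.domRestrict, and_comm]

theorem measurableSet_moved [MeasurableEq X] [MeasurableConstSMul Γ X]
    (Φ : Graphing (MulAction.orbitRel Γ X) μ) (γ : Γ) : MeasurableSet (Φ.moved γ) := by
  have : Φ.moved γ = ⋃ i, {x | x ∈ (Φ.φ i).source ∧ Φ.φ i x = γ • x} := by
    ext x
    simp [moved]
  rw [this]
  exact MeasurableSet.iUnion fun i => Φ.measurableSet_source_inter_eq_smul i γ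

/-- By freeness, the pieces on which a map of the graphing agrees with the various elements of the
group are disjoint up to null sets. -/
theorem tsum_measure_moved_le [Countable Γ] [MeasurableEq X] [MeasurableConstSMul Γ X]
    (hμ : IsFreeAction Γ μ) (Φ : Graphing (MulAction.orbitRel Γ X) μ) :
    ∑' γ, μ (Φ.moved γ) ≤ Φ.cost := by
  let p (i : ℕ) (γ : Γ) : Set X := {x | x ∈ (Φ.φ i).source ∧ Φ.φ i x = γ • x}
  have hdisj : ∀ i, Pairwise (Function.onFun (AEDisjoint μ) (p i)) := by
    intro i γ γ' hne
    refine measure_mono_null ?_ (ae_iff.1 hμ)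
    rintro x ⟨h1, h2⟩ hx
    exact hx γ γ' hne (h1.2.symm.trans h2.2)
  calc ∑' γ, μ (Φ.moved γ) ≤ ∑' γ, ∑' i, μ (p i γ) := by
        refine ENNReal.tsum_le_tsum fun γ => (measure_mono ?_).trans (measure_iUnion_le _)
        rintro x ⟨i, hi⟩
        exact Set.mem_iUnion.2 ⟨i, hi⟩
    _ = ∑' i, ∑' γ, μ (p i γ) := ENNReal.tsum_comm
    _ = ∑' i, μ (⋃ γ, p i γ) := by
        refine tsum_congr fun i => (measure_iUnion₀ (hdisj i) fun γ => ?_).symm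
        exact (Φ.measurableSet_source_inter_eq_smul i γ).nullMeasurableSet
    _ ≤ Φ.cost := ENNReal.tsum_le_tsum fun i =>
        measure_mono (Set.iUnion_subset fun γ x hx => hx.1)

/-- A path of a graphing between two points of a free orbit is a path in the graph that the
graphing induces on the group. -/
theorem eqvGen_patternEdge_of_generatedRel (Φ : Graphing (MulAction.orbitRel Γ X) μ) {x : X}
    (hx : ∀ γ γ' : Γ, γ ≠ γ' → γ • x ≠ γ' • x) {z z' : X} (h : Φ.generatedRel z z')
    {δ δ' : Γ} (hz : δ • x = z) (hz' : δ' • x = z') :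
    Relation.EqvGen (patternEdge {p : Γ × Γ | p.1 • x ∈ Φ.moved p.2}) δ δ' := by
  have hinj : ∀ γ γ' : Γ, γ • x = γ' • x → γ = γ' := fun γ γ' e => by
    by_contra hne
    exact hx γ γ' hne e
  suffices H : MulAction.orbitRel Γ X z z' ∧ ∀ δ δ' : Γ, δ • x = z → δ' • x = z' →
      Relation.EqvGen (patternEdge {p : Γ × Γ | p.1 • x ∈ Φ.moved p.2}) δ δ' from
    H.2 δ δ' hz hz'
  clear hz hz' δ δ'
  induction h with
  | rel z z' hzz =>
    obtain ⟨i, hi, rfl⟩ := hzz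
    refine ⟨Φ.rel i z hi, ?_⟩
    rintro δ δ' rfl hz'
    refine .rel _ _ ⟨δ' * δ⁻¹, ⟨i, hi, ?_⟩, by group⟩
    rw [← hz', smul_smul, inv_mul_cancel_right]
  | refl z =>
    refine ⟨Setoid.refl' _ z, fun δ δ' h h' => ?_⟩
    rw [hinj δ δ' (h.trans h'.symm)]
    exact .refl _
  | symm z z' _ ih => exact ⟨Setoid.symm' _ ih.1, fun δ δ' h h' => (ih.2 δ' δ h' h).symm⟩
  | trans z w z' _ _ ih₁ ih₂ =>
    refine ⟨Setoid.trans' _ ih₁.1 ih₂.1, fun δ δ' h h' => ?_⟩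
    obtain ⟨γ, hγ⟩ := MulAction.orbitRel_apply.1 (Setoid.symm' _ ih₁.1)
    have hw : (γ * δ) • x = w := by rw [mul_smul, h]; exact hγ
    exact (ih₁.2 δ (γ * δ) h hw).trans _ _ _ (ih₂.2 (γ * δ) δ' hw h')

/-- Almost every point realizes a finite pattern connecting `1` to every element of `S`. Such a
pattern involves finitely many of the sets `Φ.moved γ`, so it can be transferred to another
action. -/
theorem Generates.ae_exists_pattern {Φ : Graphing (MulAction.orbitRel Γ X) μ} (hΦ : Φ.Generates)
    (hμ : IsFreeAction Γ μ) (S : Finset Γ) :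
    ∀ᵐ x ∂μ, ∃ T ∈ {T : Finset (Γ × Γ) | ∀ s ∈ S, Relation.EqvGen (patternEdge (T : Set _)) 1 s},
      ∀ p ∈ T, p.1 • x ∈ Φ.moved p.2 := by
  classical
  filter_upwards [hΦ, hμ] with x hgen hfree
  have h : ∀ s : Γ, ∃ T : Finset (Γ × Γ), (T : Set (Γ × Γ)) ⊆ {p | p.1 • x ∈ Φ.moved p.2} ∧
      Relation.EqvGen (patternEdge (T : Set (Γ × Γ))) 1 s := by
    intro s
    refine exists_finset_eqvGen_patternEdge ?_
    refine Φ.eqvGen_patternEdge_of_generatedRel hfree ((hgen (s • x)).1 ?_) (one_smul _ x) rfl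
    exact Setoid.symm' _ (MulAction.orbitRel_apply.2 (MulAction.mem_orbit x s))
  choose T hT hTs using h
  refine ⟨S.biUnion T, fun s hs => patternEdge_mono ?_ (hTs s), fun p hp => ?_⟩
  · exact_mod_cast Finset.subset_biUnion_of_mem T hs
  · obtain ⟨s, _, hps⟩ := Finset.mem_biUnion.1 hp
    exact hT s hps

/-- The graphing that moves the points of `D i` by `g i`. -/
def ofSMul [MeasurableConstSMul Γ X] [SMulInvariantMeasure Γ X μ] (g : ℕ → Γ) (D : ℕ → Set X)
    (hD : ∀ i, MeasurableSet (D i)) : Graphing (MulAction.orbitRel Γ X) μ where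
  φ i := (MulAction.toPerm (g i) : Equiv.Perm X).toPartialEquiv.restr (D i)
  measurableSet_source i := by simpa using hD i
  measurableSet_target i := by
    simpa using! measurable_const_smul (g i)⁻¹ (hD i)
  measurable_toFun i := (measurable_const_smul (g i)).comp measurable_subtype_coe
  measurable_invFun i := (measurable_const_smul (g i)⁻¹).comp measurable_subtype_coe
  measure_image i s _ _ := measure_smul μ (g i) s
  rel i x _ := Setoid.symm' _ (MulAction.orbitRel_apply.2 (MulAction.mem_orbit x (g i)))

end Graphing

/-- A family of sets whose edges connect almost every point to its images under a generating set
bounds the cost. -/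
theorem actionCost_le_tsum [Countable Γ] [MeasurableConstSMul Γ X] [SMulInvariantMeasure Γ X μ]
    {S : Set Γ} (hS : Subgroup.closure S = ⊤) {C : Γ → Set X} (hC : ∀ γ, MeasurableSet (C γ))
    (hconn : ∀ s ∈ S, ∀ᵐ x ∂μ, Relation.EqvGen (smulEdge C) x (s • x)) :
    actionCost Γ μ ≤ ∑' γ, μ (C γ) := by
  classical
  let _ : Encodable Γ := Encodable.ofCountable Γ
  let D (i : ℕ) : Set X := ⋃ γ ∈ Encodable.decode₂ Γ i, C γ
  have hD : ∀ i, MeasurableSet (D i) := fun i =>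
    Encodable.iUnion_decode₂_cases (C := MeasurableSet) MeasurableSet.empty hC
  let Φ : Graphing (MulAction.orbitRel Γ X) μ :=
    Graphing.ofSMul (fun i => (Encodable.decode₂ Γ i).getD 1) D hD
  have hsource : ∀ i, (Φ.φ i).source = D i := fun i => by simp [Φ, Graphing.ofSMul]
  have hedge : ∀ x y, smulEdge C x y → Φ.generatedRel x y := by
    rintro x y ⟨γ, hγ, rfl⟩
    refine .rel _ _ ⟨Encodable.encode γ, ?_, ?_⟩
    · rw [hsource]
      simpa [D, Encodable.decode₂_encode] using hγ
    · simp [Φ, Graphing.ofSMul, Encodable.decode₂_encode]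
  have hgen_sub : ∀ x y, Φ.generatedRel x y → MulAction.orbitRel Γ X x y := by
    intro x y h
    refine Setoid.eqvGen_le (s := MulAction.orbitRel Γ X) ?_ h
    rintro a b ⟨i, hi, rfl⟩
    exact Φ.rel i a hi
  have hgen : Φ.Generates := by
    -- Discard the whole orbits of the exceptional points.
    have h : ∀ᵐ x ∂μ, ∀ γ : Γ, ∀ s : S, Φ.generatedRel (γ • x) ((s : Γ) • γ • x) := by
      refine ae_all_iff.2 fun γ => ae_all_iff.2 fun s => ?_
      refine (measurePreserving_smul γ μ).quasiMeasurePreserving.ae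
        (p := fun x => Φ.generatedRel x ((s : Γ) • x)) ?_
      filter_upwards [hconn s s.2] with x hx
      exact Setoid.eqvGen_le (s := Relation.EqvGen.setoid _) hedge hx
    filter_upwards [h] with x hx y
    refine ⟨fun hxy => ?_, hgen_sub x y⟩
    obtain ⟨γ, rfl⟩ := MulAction.orbitRel_apply.1 (Setoid.symm' _ hxy)
    suffices H : ∀ δ : Γ, Φ.generatedRel (δ • x) ((γ * δ) • x) by simpa using H 1
    clear hxy
    have hγ : γ ∈ Subgroup.closure S := hS ▸ Subgroup.mem_top γ
    induction hγ using Subgroup.closure_induction with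
    | mem s hs => intro δ; simpa [mul_smul] using hx δ ⟨s, hs⟩
    | one => intro δ; rw [one_mul]; exact .refl _
    | mul a b _ _ iha ihb =>
      intro δ
      rw [mul_assoc]
      exact (ihb δ).trans _ _ _ (iha (b * δ))
    | inv a _ ih => intro δ; simpa using! (ih (a⁻¹ * δ)).symm
  calc actionCost Γ μ ≤ Φ.cost := iInf₂_le Φ hgen
    _ = ∑' i, μ (D i) := tsum_congr fun i => by rw [hsource]
    _ = ∑' γ, μ (C γ) := tsum_iUnion_decode₂ (fun s => μ s) measure_empty C

end Graphings

/-! ### Monotonicity of the cost -/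

theorem countable_of_fg (Γ : Type*) [Group Γ] [Group.FG Γ] : Countable Γ := by
  obtain ⟨α, _, φ, hφ⟩ := Group.fg_iff_exists_freeGroup_hom_surjective_finite.1 ‹Group.FG Γ›
  exact hφ.countable

/-- Among free actions, factors of Bernoulli shifts have the largest cost. -/
theorem actionCost_le_of_isFactorOfBernoulli {Γ : Type*} [Group Γ] [Group.FG Γ]
    {X : Type*} [MeasurableSpace X] [StandardBorelSpace X] [MulAction Γ X]
    [MeasurableConstSMul Γ X] (μ : Measure X) [IsProbabilityMeasure μ] [SMulInvariantMeasure Γ X μ]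
    {K : Type*} [MeasurableSpace K] (κ : Measure K) [IsProbabilityMeasure κ]
    {Y : Type*} [MeasurableSpace Y] [StandardBorelSpace Y] [MulAction Γ Y]
    [MeasurableConstSMul Γ Y] (ν : Measure Y)
    (hμ : IsFreeAction Γ μ) (hν : IsFreeAction Γ ν) (hfactor : IsFactorOfBernoulli Γ κ ν) :
    actionCost Γ μ ≤ actionCost Γ ν := by
  classical
  have : Countable Γ := countable_of_fg Γ
  obtain ⟨S, hS⟩ := (Group.FG.out : (⊤ : Subgroup Γ).FG)
  refine le_iInf₂ fun Φ hΦ => le_trans ?_ (Φ.tsum_measure_moved_le hν)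
  refine ENNReal.le_of_forall_pos_le_add fun ε hε _ => ?_
  obtain ⟨B, hB, hBε⟩ := exists_transfer_patterns κ μ hμ hfactor Φ.measurableSet_moved _
    (hΦ.ae_exists_pattern hν S) S.card (ENNReal.coe_pos.2 hε)
  refine le_trans ?_ hBε
  set 𝒯 := {T : Finset (Γ × Γ) | ∀ s ∈ S, Relation.EqvGen (patternEdge (T : Set _)) 1 s}
  set bad := {x | ¬ ∃ T ∈ 𝒯, ∀ p ∈ T, p.1 • x ∈ B p.2} with hbad_def
  have hbad : MeasurableSet bad := by
    have : bad = (⋃ T ∈ 𝒯, ⋂ p ∈ T, (fun x => p.1 • x) ⁻¹' B p.2)ᶜ := by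
      ext x
      simp [hbad_def]
    rw [this]
    exact (MeasurableSet.biUnion (Set.to_countable 𝒯) fun T _ =>
      Finset.measurableSet_biInter _ fun p _ => measurable_const_smul p.1 (hB p.2)).compl
  -- On the bad set all generators are added to the graphing.
  let E (γ : Γ) : Set X := if γ ∈ S then bad else ∅
  have hE : ∀ γ, MeasurableSet (E γ) := fun γ => by
    dsimp only [E]
    split_ifs
    exacts [hbad, MeasurableSet.empty]
  have hEsum : ∑' γ, μ (E γ) = S.card * μ bad := by
    rw [tsum_eq_sum (s := S) fun γ hγ => by simp [E, hγ], ← nsmul_eq_mul, ← Finset.sum_const]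
    exact Finset.sum_congr rfl fun γ hγ => by simp [E, hγ]
  calc actionCost Γ μ ≤ ∑' γ, μ (B γ ∪ E γ) := by
        refine actionCost_le_tsum hS (fun γ => (hB γ).union (hE γ)) fun s hs =>
          Filter.Eventually.of_forall fun x => ?_
        by_cases hx : x ∈ bad
        · refine .rel _ _ ⟨s, Or.inr ?_, rfl⟩
          simpa [E, Finset.mem_coe.1 hs] using hx
        · obtain ⟨T, hT, hp⟩ := not_not.1 hx
          have := eqvGen_smulEdge_of_patternEdge (A := fun γ => B γ ∪ E γ) (T := (T : Set _))
            (fun p hpT => Or.inl (hp p hpT)) (hT s hs)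
          rwa [one_smul] at this
    _ ≤ ∑' γ, (μ (B γ) + μ (E γ)) := ENNReal.tsum_le_tsum fun γ => measure_union_le _ _
    _ = ∑' γ, μ (B γ) + S.card * μ bad := by rw [ENNReal.tsum_add, hEsum]

theorem corollary2 (Γ : Type*) [Group Γ] [Group.FG Γ] :
    -- every free p.m.p. action costs at most as much as every free factor of an i.i.d. process
    (∀ (X : Type*) [MeasurableSpace X] [StandardBorelSpace X] [MulAction Γ X]
        [MeasurableConstSMul Γ X] (μ : Measure X) [IsProbabilityMeasure μ]
        [SMulInvariantMeasure Γ X μ]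
        (K : Type*) [MeasurableSpace K] (κ : Measure K) [IsProbabilityMeasure κ]
        (Y : Type*) [MeasurableSpace Y] [StandardBorelSpace Y] [MulAction Γ Y]
        [MeasurableConstSMul Γ Y] (ν : Measure Y) [IsProbabilityMeasure ν]
        [SMulInvariantMeasure Γ Y ν],
        IsFreeAction Γ μ → IsFreeAction Γ ν → IsFactorOfBernoulli Γ κ ν →
        actionCost Γ μ ≤ actionCost Γ ν) ∧
    -- any two free factors of i.i.d. processes have the same cost
    (∀ (K₁ : Type*) [MeasurableSpace K₁] (κ₁ : Measure K₁) [IsProbabilityMeasure κ₁]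
        (Y₁ : Type*) [MeasurableSpace Y₁] [StandardBorelSpace Y₁] [MulAction Γ Y₁]
        [MeasurableConstSMul Γ Y₁] (ν₁ : Measure Y₁) [IsProbabilityMeasure ν₁]
        [SMulInvariantMeasure Γ Y₁ ν₁]
        (K₂ : Type*) [MeasurableSpace K₂] (κ₂ : Measure K₂) [IsProbabilityMeasure κ₂]
        (Y₂ : Type*) [MeasurableSpace Y₂] [StandardBorelSpace Y₂] [MulAction Γ Y₂]
        [MeasurableConstSMul Γ Y₂] (ν₂ : Measure Y₂) [IsProbabilityMeasure ν₂]
        [SMulInvariantMeasure Γ Y₂ ν₂],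
        IsFreeAction Γ ν₁ → IsFactorOfBernoulli Γ κ₁ ν₁ →
        IsFreeAction Γ ν₂ → IsFactorOfBernoulli Γ κ₂ ν₂ →
        actionCost Γ ν₁ = actionCost Γ ν₂) :=
  ⟨fun _ _ _ _ _ μ _ _ _ _ κ _ _ _ _ _ _ ν _ _ hμ hν hf =>
      actionCost_le_of_isFactorOfBernoulli μ κ ν hμ hν hf,
    fun _ _ κ₁ _ _ _ _ _ _ ν₁ _ _ _ _ κ₂ _ _ _ _ _ _ ν₂ _ _ h₁ hf₁ h₂ hf₂ =>
      le_antisymm (actionCost_le_of_isFactorOfBernoulli ν₁ κ₂ ν₂ h₁ h₂ hf₂)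
        (actionCost_le_of_isFactorOfBernoulli ν₂ κ₁ ν₁ h₂ h₁ hf₁)⟩
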